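/- Fix the number of arms $K$. For each horizon $T$ let $\mathcal P_a=\mathcal P_{a}^{(T)}$, $a\in[K]$, be reward distributions on $\mathbb R$ (allowed to change with $T$), with means $\mu_a$, variances $\sigma_a^2$ and gaps $\Delta_a=\max_b\mu_b-\mu_a$. Assume that for every arm $a$ $$\frac{\Delta_a}{\sqrt{2\log T}}\to 0\quad\text{as } T\to\infty,$$ and that there is a constant $B<\infty$, independent of $T$, such that each $\mathcal P_a$ is $\lambda_a$-sub-Gaussian, i.e. $\int e^{s(x-\mu_a)}\,\mathcal P_a(dx)\le e^{\lambda_a^2s^2/2}$ for all $s\in\mathbb R$, with $|\lambda_a|\le B$. For each $T\ge K$ the bandit is played for $T$ rounds with the UCB algorithm with known horizon $T$. In round $t$ an arm $A_t$ is chosen on the basis of the past (a filtration to which the arms and rewards are adapted) and a reward $X_t$ is received whose conditional distribution given the past is $\mathcal P_{A_t}$. In the first $K$ rounds each arm is pulled once, and for $K\le t<T$ $$A_{t+1}\in\arg\max_a\Big\{\bar X_{a,t}+\sqrt{\tfrac{2\log T}{n_{a,t}}}\Big\}$$ (ties broken in any way), where $n_{a,t}=\sum_{s=1}^t 1_{\{A_s=a\}}$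 and $\bar X_{a,t}=\frac1{n_{a,t}}\sum_{s=1}^tX_s1_{\{A_s=a\}}$. Then for every arm $a\in[K]$ the estimator $$\hat\sigma_a^2=\frac1{n_{a,T}}\sum_{t=1}^T\big(X_t-\bar X_{a,T}\big)^2\,1_{\{A_t=a\}}$$ is consistent for $\sigma_a^2$: $\hat\sigma_a^2-\sigma_a^2\to0$ in probability as $T\to\infty$. -/

import Mathlib

open MeasureTheory ProbabilityTheory Filter Topology

namespace UCB

noncomputable section

/-- The mean `μ_a` of a reward distribution. -/
def mean (P : Measure ℝ) : ℝ := ∫ x, x ∂P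

/-- The sub-optimality gap `Δ_a = max_b μ_b - μ_a` of arm `a`. -/
def gap {K : ℕ} (P : Fin K → Measure ℝ) (a : Fin K) : ℝ :=
  (⨆ b, mean (P b)) - mean (P a)

/-- `P` is `lam`-sub-Gaussian: `E exp (s (X - E X)) ≤ exp (lam² s² / 2)` for all real `s`,
where `X` has law `P` (with the exponential moments finite). -/
def IsSubGaussian (lam : ℝ) (P : Measure ℝ) : Prop :=
  HasSubgaussianMGF (fun x : ℝ => x - mean P) (‖lam‖₊ ^ 2) P

variable {Ω : Type*} {K : ℕ}

/-- `n_{a,t}`: the number of rounds among `1, …, t` in which arm `a` is pulled. -/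
def pullCount (A : ℕ → Ω → Fin K) (a : Fin K) (t : ℕ) (ω : Ω) : ℕ :=
  ((Finset.Icc 1 t).filter (fun s => A s ω = a)).card

/-- `X̄_{a,t}`: the mean of the rewards of arm `a` in the rounds `1, …, t`. -/
def sampleMean (A : ℕ → Ω → Fin K) (X : ℕ → Ω → ℝ) (a : Fin K) (t : ℕ) (ω : Ω) : ℝ :=
  (∑ s ∈ Finset.Icc 1 t, if A s ω = a then X s ω else 0) / (pullCount A a t ω : ℝ)

/-- The plug-in variance estimator `σ̂²_a` after `T` rounds. -/
def varEstimator (A : ℕ → Ω → Fin K) (X : ℕ → Ω → ℝ) (a : Fin K) (T : ℕ) (ω : Ω) : ℝ :=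
  (∑ t ∈ Finset.Icc 1 T, if A t ω = a then (X t ω - sampleMean A X a T ω) ^ 2 else 0) /
    (pullCount A a T ω : ℝ)

/-- `UCB(a,t) = X̄_{a,t} + √(2 log T / n_{a,t})` for the horizon `T`. -/
def ucbIndex (A : ℕ → Ω → Fin K) (X : ℕ → Ω → ℝ) (T : ℕ) (a : Fin K) (t : ℕ) (ω : Ω) : ℝ :=
  sampleMean A X a t ω + √(2 * Real.log (T : ℝ) / (pullCount A a t ω : ℝ))

/-- `A 1, …, A T` and `X 1, …, X T` are the arms pulled and the rewards received when the
`K`-armed bandit with reward distributions `P` is played for `T` rounds with the UCB algorithm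
of known horizon `T`; `ℱ t` is the information available after round `t`. -/
structure IsUCBRun [mΩ : MeasurableSpace Ω] (ν : Measure Ω) (ℱ : Filtration ℕ mΩ)
    (P : Fin K → Measure ℝ) (T : ℕ) (A : ℕ → Ω → Fin K) (X : ℕ → Ω → ℝ) : Prop where
  /-- The arm of each round is chosen on the basis of the past. -/
  arm_measurable : ∀ t < T, Measurable[ℱ t] (A (t + 1))
  /-- Each reward is observed at the end of its round. -/
  reward_measurable : ∀ t < T, Measurable[ℱ (t + 1)] (X (t + 1))
  /-- Given the past, the reward of a round has the distribution of the arm pulled. -/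
  reward_law : ∀ t < T, ∀ S : Set ℝ, MeasurableSet S →
    ν⟦X (t + 1) ⁻¹' S | ℱ t⟧ =ᵐ[ν] fun ω => (P (A (t + 1) ω)).real S
  /-- In the first `K` rounds each arm is pulled once. -/
  initial_pulls : ∀ᵐ ω ∂ν, ∀ a, pullCount A a K ω = 1
  /-- In each later round an arm with the largest UCB index is pulled (ties are broken in any
  way). -/
  ucb_rule : ∀ t, K ≤ t → t < T →
    ∀ᵐ ω ∂ν, ∀ b, ucbIndex A X T b t ω ≤ ucbIndex A X T (A (t + 1) ω) t ω

end

end UCB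

namespace UCB

/-! ### Moments of sub-Gaussian laws -/

section Moments

/-! For a centred function `f` of the rewards of arm `a`, let `S` be the sum of `f` over its pulls
and `n` their number. Then `S² / (n + m)² + V / (n + m)` is a supermartingale starting at `V / m`,
however the arms are chosen, so Markov's inequality gives `|S| < δ (n + m)` with probability at
least `1 - V / (m δ²)` (`IsUCBRun.measure_armSum_ge_le`). Taking `f` to be `x - μ` and `(x - μ)² -
σ²` settles the claim once `n ≥ m`, because then `n + m ≤ 2n`.

That `n ≥ m` is a pathwise fact (`le_pullCount_of_ucb`). Off a small event all empirical second
moments are bounded, hence so are the sample means around the true ones. If arm `a` had fewer than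
`m` pulls, some arm `b` would have more than `4m`; at the last pull of `b` the bonus of `a` exceeds
that of `b` by at least `√(2 log T / m) / 2`, which for large `T` beats the gap and the errors of
the means, contradicting the choice of `b`. The number `m` is fixed before `T → ∞`. -/

lemma pow_four_le_exp_add_exp (x : ℝ) : x ^ 4 ≤ 24 * (Real.exp x + Real.exp (-x)) := by
  have h := Real.pow_div_factorial_le_exp |x| (abs_nonneg x) 4
  have h2 : Real.exp |x| ≤ Real.exp x + Real.exp (-x) := by
    rcases abs_choice x with h | h <;> rw [h] <;> linarith [Real.exp_pos x, Real.exp_pos (-x)]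
  rw [Even.pow_abs (by decide)] at h
  norm_num [Nat.factorial] at h
  linarith

/-- The bound on the centred second and fourth moments of a `B`-sub-Gaussian law. -/
noncomputable def momentBound (B : ℝ) : ℝ := 48 * Real.exp (B ^ 2 / 2) + 1

lemma one_le_momentBound (B : ℝ) : 1 ≤ momentBound B := by
  unfold momentBound; linarith [Real.exp_pos (B ^ 2 / 2)]

variable {P : Measure ℝ} {lam B : ℝ}

lemma variance_eq_integral_sub_mean_sq : variance id P = ∫ x, (x - mean P) ^ 2 ∂P := by
  rw [variance_eq_integral (by fun_prop)]; rfl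

lemma IsSubGaussian.integrable_pow_four (h : IsSubGaussian lam P) :
    Integrable (fun x => (x - mean P) ^ 4) P := by
  have h1 := h.integrable_exp_mul 1
  have h2 := h.integrable_exp_mul (-1)
  simp only [one_mul, neg_mul] at h1 h2
  refine ((h1.add h2).const_mul 24).mono' (by fun_prop) (.of_forall fun x => ?_)
  rw [Real.norm_of_nonneg (by positivity)]
  exact pow_four_le_exp_add_exp _

lemma IsSubGaussian.integral_pow_four_le (h : IsSubGaussian lam P) (hl : |lam| ≤ B) :
    ∫ x, (x - mean P) ^ 4 ∂P ≤ momentBound B - 1 := by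
  have h1 := h.integrable_exp_mul 1
  have h2 := h.integrable_exp_mul (-1)
  have m1 := h.mgf_le 1
  have m2 := h.mgf_le (-1)
  simp only [mgf, one_mul, neg_mul] at h1 h2 m1 m2
  have hle : ∫ x, (x - mean P) ^ 4 ∂P ≤
      ∫ x, 24 * (Real.exp (x - mean P) + Real.exp (-(x - mean P))) ∂P :=
    integral_mono h.integrable_pow_four ((h1.add h2).const_mul 24)
      fun x => pow_four_le_exp_add_exp _
  rw [integral_const_mul, integral_add h1 h2] at hle
  have hc : lam ^ 2 ≤ B ^ 2 := sq_le_sq' (by linarith [neg_abs_le lam]) ((le_abs_self _).trans hl)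
  have he : Real.exp (lam ^ 2 / 2) ≤ Real.exp (B ^ 2 / 2) := Real.exp_le_exp.2 (by linarith)
  simp only [NNReal.coe_pow, coe_nnnorm, Real.norm_eq_abs, sq_abs, one_pow, mul_one, even_two,
    Even.neg_pow] at m1 m2
  unfold momentBound
  linarith

lemma IsSubGaussian.memLp_two_sq (h : IsSubGaussian lam P) :
    MemLp (fun x => (x - mean P) ^ 2) 2 P := by
  rw [memLp_two_iff_integrable_sq (by fun_prop)]
  convert! h.integrable_pow_four using 2
  ring

variable [IsProbabilityMeasure P]

lemma IsSubGaussian.integrable_sq (h : IsSubGaussian lam P) :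
    Integrable (fun x => (x - mean P) ^ 2) P := h.memLp_two_sq.integrable one_le_two

lemma IsSubGaussian.memLp_two (h : IsSubGaussian lam P) :
    MemLp (fun x => x - mean P) 2 P :=
  (memLp_two_iff_integrable_sq (by fun_prop)).2 h.integrable_sq

lemma IsSubGaussian.integrable_id (h : IsSubGaussian lam P) : Integrable (fun x : ℝ => x) P := by
  convert! (h.memLp_two.integrable one_le_two).add (integrable_const (mean P)) using 2
  simp

lemma IsSubGaussian.integral_sub_mean (h : IsSubGaussian lam P) :
    ∫ x, (x - mean P) ∂P = 0 := by
  rw [integral_sub h.integrable_id (integrable_const _)]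
  simp [mean]

lemma IsSubGaussian.variance_le (h : IsSubGaussian lam P) (hl : |lam| ≤ B) :
    variance id P ≤ momentBound B := by
  have := integral_mono h.integrable_sq (h.integrable_pow_four.add (integrable_const 1))
    fun x => show (x - mean P) ^ 2 ≤ (x - mean P) ^ 4 + 1 by
      nlinarith [sq_nonneg ((x - mean P) ^ 2 - 1), sq_nonneg ((x - mean P) ^ 2)]
  rw [integral_add' h.integrable_pow_four (integrable_const 1)] at this
  simp only [integral_const, probReal_univ, one_smul] at this
  rw [variance_eq_integral_sub_mean_sq]
  linarith [h.integral_pow_four_le hl]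

lemma IsSubGaussian.integral_sq_sub_variance (h : IsSubGaussian lam P) :
    ∫ x, ((x - mean P) ^ 2 - variance id P) ∂P = 0 := by
  rw [integral_sub h.integrable_sq (integrable_const _), variance_eq_integral_sub_mean_sq]
  simp

/-- The variance of `(x - μ)²` is at most the fourth central moment. -/
lemma IsSubGaussian.integral_sq_sub_variance_sq_le (h : IsSubGaussian lam P) (hl : |lam| ≤ B) :
    ∫ x, ((x - mean P) ^ 2 - variance id P) ^ 2 ∂P ≤ momentBound B := by
  have h1 : ∀ x : ℝ, ((x - mean P) ^ 2 - variance id P) ^ 2 =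
      (x - mean P) ^ 4 - (2 * variance id P * (x - mean P) ^ 2 - variance id P ^ 2) :=
    fun x => by ring
  simp_rw [h1]
  have hi := h.integrable_sq.const_mul (2 * variance id P)
  rw [integral_sub h.integrable_pow_four (by exact hi.sub (integrable_const _)),
    integral_sub hi (integrable_const _), integral_const_mul, ← variance_eq_integral_sub_mean_sq]
  simp only [integral_const, probReal_univ, one_smul]
  nlinarith [h.integral_pow_four_le hl, sq_nonneg (variance id P)]

end Moments

/-! ### Sums over the pulls of one arm -/

section ArmSum

variable {Ω : Type*} {K : ℕ}

/-- The sum of `f (X s)` over the rounds `s ≤ t` in which arm `a` is pulled. -/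
noncomputable def armSum (A : ℕ → Ω → Fin K) (X : ℕ → Ω → ℝ) (f : ℝ → ℝ) (a : Fin K) (t : ℕ)
    (ω : Ω) : ℝ :=
  ∑ s ∈ (Finset.Icc 1 t).filter (fun s => A s ω = a), f (X s ω)

variable {A : ℕ → Ω → Fin K} {X : ℕ → Ω → ℝ} {f : ℝ → ℝ} {a : Fin K} {t : ℕ} {ω : Ω}

lemma filter_Icc_succ_of_eq (h : A (t + 1) ω = a) :
    (Finset.Icc 1 (t + 1)).filter (fun s => A s ω = a) =
      insert (t + 1) ((Finset.Icc 1 t).filter (fun s => A s ω = a)) := by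
  rw [← Finset.insert_Icc_right_eq_Icc_add_one (by omega), Finset.filter_insert, if_pos h]

lemma filter_Icc_succ_of_ne (h : A (t + 1) ω ≠ a) :
    (Finset.Icc 1 (t + 1)).filter (fun s => A s ω = a) =
      (Finset.Icc 1 t).filter (fun s => A s ω = a) := by
  rw [← Finset.insert_Icc_right_eq_Icc_add_one (by omega), Finset.filter_insert, if_neg h]

lemma armSum_succ_of_eq (h : A (t + 1) ω = a) :
    armSum A X f a (t + 1) ω = armSum A X f a t ω + f (X (t + 1) ω) := by
  rw [armSum, filter_Icc_succ_of_eq h, Finset.sum_insert (by simp), add_comm]; rfl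

lemma armSum_succ_of_ne (h : A (t + 1) ω ≠ a) :
    armSum A X f a (t + 1) ω = armSum A X f a t ω := by
  rw [armSum, filter_Icc_succ_of_ne h]; rfl

lemma pullCount_succ_of_eq (h : A (t + 1) ω = a) :
    pullCount A a (t + 1) ω = pullCount A a t ω + 1 := by
  rw [pullCount, filter_Icc_succ_of_eq h, Finset.card_insert_of_notMem (by simp)]; rfl

lemma pullCount_succ_of_ne (h : A (t + 1) ω ≠ a) :
    pullCount A a (t + 1) ω = pullCount A a t ω := by
  rw [pullCount, filter_Icc_succ_of_ne h]; rfl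

lemma sampleMean_eq_armSum :
    sampleMean A X a t ω = armSum A X (fun x => x) a t ω / pullCount A a t ω := by
  rw [sampleMean, armSum, Finset.sum_filter]

lemma armSum_const (c : ℝ) : armSum A X (fun _ => c) a t ω = pullCount A a t ω * c := by
  simp [armSum, pullCount]

lemma armSum_sub (g : ℝ → ℝ) : armSum A X (fun x => f x - g x) a t ω =
    armSum A X f a t ω - armSum A X g a t ω := by
  simp [armSum]

lemma armSum_add (g : ℝ → ℝ) : armSum A X (fun x => f x + g x) a t ω =
    armSum A X f a t ω + armSum A X g a t ω := by
  simp [armSum, Finset.sum_add_distrib]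

lemma armSum_le_armSum {g : ℝ → ℝ} (h : ∀ x, f x ≤ g x) :
    armSum A X f a t ω ≤ armSum A X g a t ω :=
  Finset.sum_le_sum fun _ _ => h _

lemma armSum_mono (h : ∀ x, 0 ≤ f x) {T : ℕ} (ht : t ≤ T) :
    armSum A X f a t ω ≤ armSum A X f a T ω :=
  Finset.sum_le_sum_of_subset_of_nonneg
    (Finset.filter_subset_filter _ (Finset.Icc_subset_Icc_right ht)) fun _ _ _ => h _

lemma pullCount_mono {T : ℕ} (ht : t ≤ T) : pullCount A a t ω ≤ pullCount A a T ω :=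
  Finset.card_le_card (Finset.filter_subset_filter _ (Finset.Icc_subset_Icc_right ht))

/-- The plug-in variance in terms of the rewards centred at an arbitrary point `c`. -/
lemma varEstimator_eq (c : ℝ) (hn : 0 < pullCount A a t ω) :
    varEstimator A X a t ω = armSum A X (fun x => (x - c) ^ 2) a t ω / pullCount A a t ω -
      (armSum A X (fun x => x - c) a t ω / pullCount A a t ω) ^ 2 := by
  have hn' : (pullCount A a t ω : ℝ) ≠ 0 := by positivity
  have h1 : varEstimator A X a t ω =
      armSum A X (fun x => (x - sampleMean A X a t ω) ^ 2) a t ω / pullCount A a t ω := by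
    rw [varEstimator, armSum, Finset.sum_filter]
  set m := sampleMean A X a t ω with hm
  have h2 : armSum A X (fun x => x - c) a t ω = pullCount A a t ω * (m - c) := by
    rw [armSum_sub, armSum_const, hm, sampleMean_eq_armSum]; field_simp
  have h3 : armSum A X (fun x => (x - m) ^ 2) a t ω =
      armSum A X (fun x => (x - c) ^ 2) a t ω
        - 2 * (m - c) * armSum A X (fun x => x - c) a t ω + pullCount A a t ω * (m - c) ^ 2 := by
    rw [← armSum_const (X := X)]
    simp only [armSum, Finset.mul_sum, ← Finset.sum_sub_distrib, ← Finset.sum_add_distrib]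
    exact Finset.sum_congr rfl fun _ _ => by ring
  rw [h1, h3, h2]
  field_simp
  ring

end ArmSum

/-! ### Rewards given the past -/

section Run

variable {Ω : Type*} {K : ℕ} [mΩ : MeasurableSpace Ω] {ν : Measure Ω}
  {ℱ : Filtration ℕ mΩ} {P : Fin K → Measure ℝ} {T : ℕ} {A : ℕ → Ω → Fin K} {X : ℕ → Ω → ℝ}
  {f : ℝ → ℝ} {a : Fin K} {t : ℕ}

lemma IsUCBRun.measurableSet_arm_eq (h : IsUCBRun ν ℱ P T A X) (ht : t < T) (a : Fin K) :
    MeasurableSet[ℱ t] {ω | A (t + 1) ω = a} :=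
  h.arm_measurable t ht (measurableSet_singleton a)

lemma IsUCBRun.measurable_armSum (h : IsUCBRun ν ℱ P T A X) (ht : t ≤ T) (hf : Measurable f) :
    Measurable[ℱ t] (armSum A X f a t) := by
  have : armSum A X f a t =
      fun ω => ∑ s ∈ Finset.Icc 1 t, if A s ω = a then f (X s ω) else 0 := by
    ext ω; rw [armSum, Finset.sum_filter]
  rw [this]
  refine Finset.measurable_fun_sum _ fun s hs => ?_
  obtain ⟨s, rfl⟩ : ∃ r, s = r + 1 := ⟨s - 1, by have := Finset.mem_Icc.1 hs; omega⟩
  have hst : s + 1 ≤ t := (Finset.mem_Icc.1 hs).2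
  refine Measurable.ite ?_ ?_ measurable_const
  · exact ℱ.mono (by omega : s ≤ t) _ (h.measurableSet_arm_eq (by omega) a)
  · exact hf.comp ((h.reward_measurable s (by omega)).mono (ℱ.mono hst) le_rfl)

lemma IsUCBRun.measurable_pullCount (h : IsUCBRun ν ℱ P T A X) (ht : t ≤ T) :
    Measurable[ℱ t] (fun ω => (pullCount A a t ω : ℝ)) := by
  have := h.measurable_armSum (a := a) ht (measurable_const (a := (1 : ℝ)))
  convert! this using 1
  ext ω
  rw [armSum_const, mul_one]

variable [IsProbabilityMeasure ν]

/-- The choice of arm is `ℱ t`-measurable, so the conditional law can be integrated over the past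
event on which it is the constant `P a`. -/
lemma IsUCBRun.measure_inter_reward (h : IsUCBRun ν ℱ P T A X)
    (hP : ∀ a, IsProbabilityMeasure (P a)) (ht : t < T) {H : Set Ω}
    (hH : MeasurableSet[ℱ t] H) {S : Set ℝ} (hS : MeasurableSet S) :
    ν (H ∩ X (t + 1) ⁻¹' S ∩ {ω | A (t + 1) ω = a}) =
      ν (H ∩ {ω | A (t + 1) ω = a}) * P a S := by
  have hD := h.measurableSet_arm_eq ht a
  have hG := hH.inter hD
  have hXS : MeasurableSet (X (t + 1) ⁻¹' S) :=
    ℱ.le _ _ (h.reward_measurable t ht hS)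
  have h1 := setIntegral_condExp (μ := ν) (ℱ.le t)
    (f := (X (t + 1) ⁻¹' S).indicator fun _ => (1 : ℝ)) ((integrable_const _).indicator hXS) hG
  have h2 : ∫ ω in H ∩ {ω | A (t + 1) ω = a}, (ν⟦X (t + 1) ⁻¹' S | ℱ t⟧) ω ∂ν =
      ∫ ω in H ∩ {ω | A (t + 1) ω = a}, (P a).real S ∂ν := by
    refine setIntegral_congr_ae (ℱ.le t _ hG) ?_
    filter_upwards [h.reward_law t ht S hS] with ω hω hmem
    rw [hω, hmem.2]
  rw [h2, setIntegral_const, integral_indicator_const _ hXS] at h1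
  simp only [smul_eq_mul, mul_one, measureReal_def, Measure.restrict_apply hXS] at h1
  rw [← ENNReal.toReal_mul, ENNReal.toReal_eq_toReal_iff' (by finiteness) (by finiteness)] at h1
  rw [h1]
  congr 1
  ext ω; simp only [Set.mem_inter_iff]; tauto

/-- On the event that arm `a` is pulled, the next reward is independent of the past with
law `P a`. -/
lemma IsUCBRun.map_prod_reward (h : IsUCBRun ν ℱ P T A X)
    (hP : ∀ a, IsProbabilityMeasure (P a)) (ht : t < T) {E : Type*} [MeasurableSpace E]
    {U : Ω → E} (hU : Measurable[ℱ t] U) :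
    (ν.restrict {ω | A (t + 1) ω = a}).map (fun ω => (U ω, X (t + 1) ω)) =
      ((ν.restrict {ω | A (t + 1) ω = a}).map U).prod (P a) := by
  have := hP a
  have hU' : Measurable U := hU.mono (ℱ.le t) le_rfl
  have hX : Measurable (X (t + 1)) := (h.reward_measurable t ht).mono (ℱ.le _) le_rfl
  refine (Measure.prod_eq fun s S hs hS => ?_).symm
  rw [Measure.map_apply (hU'.prodMk hX) (hs.prod hS), Measure.map_apply hU' hs,
    Measure.restrict_apply (hU'.prodMk hX (hs.prod hS)), Measure.restrict_apply (hU' hs),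
    ← h.measure_inter_reward hP ht (hU hs) hS]
  rfl

end Run

/-! ### The supermartingale and the adaptive law of large numbers -/

section Potential

variable {Ω : Type*} {K : ℕ} [mΩ : MeasurableSpace Ω] {ν : Measure Ω} [IsProbabilityMeasure ν]
  {ℱ : Filtration ℕ mΩ} {P : Fin K → Measure ℝ} {T : ℕ} {A : ℕ → Ω → Fin K} {X : ℕ → Ω → ℝ}
  {f : ℝ → ℝ} {a : Fin K} {t : ℕ} {V m : ℝ}

/-- The function `x² / (n + m)² + V / (n + m)`, which decreases in mean when `n` grows by one and
`x` by a centred increment of variance at most `V`. -/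
noncomputable def potential (V m x n : ℝ) : ℝ := x ^ 2 / (n + m) ^ 2 + V / (n + m)

/-- With `c = n + m`, the drop `V / c - V / (c + 1) = V / (c (c + 1))` pays for the new variance
term `V / (c + 1)²`. -/
lemma potential_step_le (hV : 0 ≤ V) (hm : 0 < m) (x : ℝ) {n : ℝ} (hn : 0 ≤ n) :
    (x ^ 2 + V) / (n + 1 + m) ^ 2 + V / (n + 1 + m) ≤ potential V m x n := by
  have hc : 0 < n + m := by linarith
  have h1 : x ^ 2 / (n + 1 + m) ^ 2 ≤ x ^ 2 / (n + m) ^ 2 := by gcongr; linarith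
  have h2 : V / (n + 1 + m) ^ 2 + V / (n + 1 + m) ≤ V / (n + m) := by
    rw [← sub_nonneg]
    have : V / (n + m) - (V / (n + 1 + m) ^ 2 + V / (n + 1 + m)) =
        V / ((n + m) * (n + 1 + m) ^ 2) := by
      field_simp
      ring
    rw [this]
    positivity
  rw [potential, add_div]
  linarith

lemma lintegral_potential_add_le {Q : Measure ℝ} [IsProbabilityMeasure Q] (hf : MemLp f 2 Q)
    (hf0 : ∫ x, f x ∂Q = 0) (hfV : ∫ x, f x ^ 2 ∂Q ≤ V) (hm : 0 < m) (x : ℝ) {n : ℝ}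
    (hn : 0 ≤ n) :
    ∫⁻ y, ENNReal.ofReal (potential V m (x + f y) (n + 1)) ∂Q ≤
      ENNReal.ofReal (potential V m x n) := by
  have hV : 0 ≤ V := (integral_nonneg fun y => sq_nonneg (f y)).trans hfV
  have hi1 := (hf.integrable one_le_two).const_mul (2 * x)
  have hi2 := hf.integrable_sq
  have e1 : (fun y => (x + f y) ^ 2) = fun y => x ^ 2 + (2 * x * f y + f y ^ 2) := by
    ext y; ring
  have hi : Integrable (fun y => (x + f y) ^ 2) Q := by
    rw [e1]; exact (integrable_const _).add (hi1.add hi2)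
  have hsq : ∫ y, (x + f y) ^ 2 ∂Q ≤ x ^ 2 + V := by
    rw [e1, integral_add (integrable_const _) (by exact hi1.add hi2), integral_add hi1 hi2,
      integral_const_mul, hf0]
    simpa using hfV
  have hc : 0 < n + 1 + m := by linarith
  rw [← ofReal_integral_eq_lintegral_ofReal]
  · refine ENNReal.ofReal_le_ofReal (le_trans ?_ (potential_step_le hV hm x hn))
    simp only [potential]
    rw [integral_add (hi.div_const _) (integrable_const _), integral_div]
    simp only [integral_const, probReal_univ, one_smul]
    gcongr
  · exact (hi.div_const _).add (integrable_const _)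
  · exact .of_forall fun y => by unfold potential; positivity

lemma measurable_potential : Measurable fun p : ℝ × ℝ => potential V m p.1 p.2 := by
  unfold potential; fun_prop

/-- Nothing changes where `a` is not pulled; where it is, Fubini reduces the claim to the one-step
bound for a fixed past. -/
lemma IsUCBRun.lintegral_potential_succ_le (h : IsUCBRun ν ℱ P T A X)
    (hP : ∀ a, IsProbabilityMeasure (P a)) (ht : t < T) (hfm : Measurable f)
    (hf : MemLp f 2 (P a)) (hf0 : ∫ x, f x ∂(P a) = 0) (hfV : ∫ x, f x ^ 2 ∂(P a) ≤ V)
    (hm : 0 < m) :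
    ∫⁻ ω, ENNReal.ofReal
        (potential V m (armSum A X f a (t + 1) ω) (pullCount A a (t + 1) ω)) ∂ν ≤
      ∫⁻ ω, ENNReal.ofReal (potential V m (armSum A X f a t ω) (pullCount A a t ω)) ∂ν := by
  have := hP a
  set D := {ω | A (t + 1) ω = a} with hD
  have hDm : MeasurableSet D := ℱ.le t _ (h.measurableSet_arm_eq ht a)
  rw [← lintegral_add_compl _ hDm, ← lintegral_add_compl (μ := ν) (A := D) (fun ω =>
    ENNReal.ofReal (potential V m (armSum A X f a t ω) (pullCount A a t ω))) hDm]
  refine add_le_add ?_ (le_of_eq ?_)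
  · let U : Ω → ℝ × ℝ := fun ω => (armSum A X f a t ω, (pullCount A a t ω : ℝ))
    have hU : Measurable[ℱ t] U :=
      (h.measurable_armSum ht.le hfm).prodMk (h.measurable_pullCount ht.le)
    have hU' : Measurable U := hU.mono (ℱ.le t) le_rfl
    have hX : Measurable (X (t + 1)) := (h.reward_measurable t ht).mono (ℱ.le _) le_rfl
    let G : (ℝ × ℝ) × ℝ → ENNReal :=
      fun p => ENNReal.ofReal (potential V m (p.1.1 + f p.2) (p.1.2 + 1))
    have hG : Measurable G := by
      have hstep : Measurable fun p : (ℝ × ℝ) × ℝ => (p.1.1 + f p.2, p.1.2 + 1) := by fun_prop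
      exact ENNReal.measurable_ofReal.comp (measurable_potential.comp hstep)
    calc _ = ∫⁻ ω in D, G (U ω, X (t + 1) ω) ∂ν := by
          refine setLIntegral_congr_fun hDm fun ω hω => ?_
          simp only [G, U]
          rw [armSum_succ_of_eq hω, pullCount_succ_of_eq hω, Nat.cast_add, Nat.cast_one]
      _ = ∫⁻ p, G p ∂(((ν.restrict D).map U).prod (P a)) := by
          rw [← h.map_prod_reward hP ht hU, lintegral_map hG (hU'.prodMk hX)]
      _ = ∫⁻ ω in D, ∫⁻ y, G (U ω, y) ∂(P a) ∂ν := by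
          rw [lintegral_prod _ hG.aemeasurable, lintegral_map hG.lintegral_prod_right' hU']
      _ ≤ _ := lintegral_mono fun ω =>
          lintegral_potential_add_le hf hf0 hfV hm _ (Nat.cast_nonneg _)
  · refine setLIntegral_congr_fun hDm.compl fun ω hω => ?_
    rw [armSum_succ_of_ne hω, pullCount_succ_of_ne hω]

lemma IsUCBRun.lintegral_potential_le (h : IsUCBRun ν ℱ P T A X)
    (hP : ∀ a, IsProbabilityMeasure (P a)) (hfm : Measurable f)
    (hf : MemLp f 2 (P a)) (hf0 : ∫ x, f x ∂(P a) = 0) (hfV : ∫ x, f x ^ 2 ∂(P a) ≤ V)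
    (hm : 0 < m) (ht : t ≤ T) :
    ∫⁻ ω, ENNReal.ofReal (potential V m (armSum A X f a t ω) (pullCount A a t ω)) ∂ν ≤
      ENNReal.ofReal (V / m) := by
  induction t with
  -- At time `0` both sum and count vanish, so the potential is exactly `V / m`.
  | zero => simp [armSum, pullCount, potential]
  | succ t ih =>
    exact (h.lintegral_potential_succ_le hP ht hfm hf hf0 hfV hm).trans (ih (by omega))

/-- The law of large numbers for adaptively sampled centred rewards. -/
lemma IsUCBRun.measure_armSum_ge_le (h : IsUCBRun ν ℱ P T A X)
    (hP : ∀ a, IsProbabilityMeasure (P a)) (hfm : Measurable f)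
    (hf : MemLp f 2 (P a)) (hf0 : ∫ x, f x ∂(P a) = 0) (hfV : ∫ x, f x ^ 2 ∂(P a) ≤ V)
    (hm : 0 < m) {δ : ℝ} (hδ : 0 < δ) :
    ν {ω | δ * (pullCount A a T ω + m) ≤ |armSum A X f a T ω|} ≤
      ENNReal.ofReal (V / (m * δ ^ 2)) := by
  have hV : 0 ≤ V := (integral_nonneg fun y => sq_nonneg (f y)).trans hfV
  have hδ' : ENNReal.ofReal (δ ^ 2) ≠ 0 := (ENNReal.ofReal_pos.2 (by positivity)).ne'
  have hU : Measurable fun ω => (armSum A X f a T ω, (pullCount A a T ω : ℝ)) :=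
    ((h.measurable_armSum le_rfl hfm).mono (ℱ.le T) le_rfl).prodMk
      ((h.measurable_pullCount le_rfl).mono (ℱ.le T) le_rfl)
  have hmeas : Measurable fun ω =>
      ENNReal.ofReal (potential V m (armSum A X f a T ω) (pullCount A a T ω)) :=
    ((measurable_potential (V := V) (m := m)).comp hU).ennreal_ofReal
  have hsub : {ω | δ * (pullCount A a T ω + m) ≤ |armSum A X f a T ω|} ⊆
      {ω | ENNReal.ofReal (δ ^ 2) ≤
        ENNReal.ofReal (potential V m (armSum A X f a T ω) (pullCount A a T ω))} := by
    intro ω hω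
    have hc : 0 < (pullCount A a T ω : ℝ) + m := by positivity
    rw [Set.mem_ofPred_eq] at hω ⊢
    refine ENNReal.ofReal_le_ofReal ?_
    have h1 : δ ^ 2 ≤ armSum A X f a T ω ^ 2 / (pullCount A a T ω + m) ^ 2 := by
      rw [le_div_iff₀ (by positivity), ← mul_pow, ← sq_abs (armSum A X f a T ω)]
      exact pow_le_pow_left₀ (by positivity) hω 2
    have h2 : 0 ≤ V / (pullCount A a T ω + m) := by positivity
    unfold potential
    linarith
  refine (measure_mono hsub).trans ?_
  refine (meas_ge_le_lintegral_div hmeas.aemeasurable hδ' ENNReal.ofReal_ne_top).trans ?_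
  rw [← div_div, ENNReal.ofReal_div_of_pos (by positivity)]
  exact ENNReal.div_le_div_right (h.lintegral_potential_le hP hfm hf hf0 hfV hm le_rfl) _

end Potential

/-! ### Pathwise consequences of the UCB rule -/

section Exploration

variable {Ω : Type*} {K : ℕ} {A : ℕ → Ω → Fin K} {X : ℕ → Ω → ℝ} {a b : Fin K} {t T m : ℕ} {ω : Ω}

/-- Since `|y| ≤ y² + 1`, the second moment at the horizon controls all earlier sums at once, with
no maximal inequality. -/
lemma abs_armSum_le {μ C : ℝ} (ht : t ≤ T)
    (hC : armSum A X (fun x => (x - μ) ^ 2) b T ω ≤ C * pullCount A b T ω) :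
    |armSum A X (fun x => x - μ) b t ω| ≤ (C + 1) * pullCount A b T ω := by
  calc |armSum A X (fun x => x - μ) b t ω| ≤ armSum A X (fun x => |x - μ|) b t ω :=
        Finset.abs_sum_le_sum_abs _ _
    _ ≤ armSum A X (fun x => |x - μ|) b T ω := armSum_mono (fun _ => abs_nonneg _) ht
    _ ≤ armSum A X (fun x => (x - μ) ^ 2 + 1) b T ω := armSum_le_armSum fun x => by
        rw [← sq_abs]; nlinarith [sq_nonneg (|x - μ| - 1), abs_nonneg (x - μ)]
    _ ≤ _ := by rw [armSum_add, armSum_const]; linarith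

lemma abs_sampleMean_sub_le {μ C r : ℝ} (ht : t ≤ T) (hn : 0 < pullCount A b t ω) (hC0 : 0 ≤ C)
    (hC : armSum A X (fun x => (x - μ) ^ 2) b T ω ≤ C * pullCount A b T ω)
    (hr : (pullCount A b T ω : ℝ) ≤ r * pullCount A b t ω) :
    |sampleMean A X b t ω - μ| ≤ r * (C + 1) := by
  have hn' : (0 : ℝ) < pullCount A b t ω := by exact_mod_cast hn
  have h1 : sampleMean A X b t ω - μ =
      armSum A X (fun x => x - μ) b t ω / pullCount A b t ω := by
    rw [armSum_sub, armSum_const, sampleMean_eq_armSum]; field_simp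
  rw [h1, abs_div, abs_of_pos hn', div_le_iff₀ hn']
  refine (abs_armSum_le ht hC).trans ?_
  calc (C + 1) * (pullCount A b T ω : ℝ) ≤ (C + 1) * (r * pullCount A b t ω) := by gcongr
    _ = _ := by ring

lemma exists_le_pullCount (n : ℕ) (a : Fin K) (hT : K * n ≤ T) :
    ∃ b, n ≤ pullCount A b T ω := by
  obtain ⟨b, -, hb⟩ := Finset.exists_le_card_fiber_of_mul_le_card_of_maps_to
    (s := Finset.Icc 1 T) (t := Finset.univ) (f := fun s => A s ω) (n := n)
    (fun _ _ => Finset.mem_univ _) ⟨a, Finset.mem_univ a⟩ (by simpa using hT)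
  exact ⟨b, hb⟩

/-- The last pull of an arm. -/
lemma exists_last_pull (h : 0 < pullCount A b T ω) :
    ∃ t < T, A (t + 1) ω = b ∧ pullCount A b T ω = pullCount A b t ω + 1 := by
  induction T with
  | zero => simp [pullCount] at h
  | succ T ih =>
    by_cases hb : A (T + 1) ω = b
    · exact ⟨T, by omega, hb, pullCount_succ_of_eq hb⟩
    · rw [pullCount_succ_of_ne hb] at h ⊢
      obtain ⟨t, ht, h⟩ := ih h
      exact ⟨t, by omega, h⟩

/-- If the rewards of all arms have bounded empirical second moments and the exploration bonus is
large compared to the gaps, then every arm is pulled often. -/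
lemma le_pullCount_of_ucb {μ : Fin K → ℝ} {C g : ℝ} (hm : 1 ≤ m) (hC0 : 0 ≤ C)
    (hinit : ∀ b, pullCount A b K ω = 1)
    (hrule : ∀ t, K ≤ t → t < T → ∀ b, ucbIndex A X T b t ω ≤ ucbIndex A X T (A (t + 1) ω) t ω)
    (hC : ∀ b, armSum A X (fun x => (x - μ b) ^ 2) b T ω ≤ C * pullCount A b T ω)
    (hT : K * (4 * m + 1) ≤ T) (hg : ∀ b, μ b - μ a ≤ g)
    (hbig : (m + 2) * (C + 1) + g < √(2 * Real.log (T : ℝ) / m) / 2) :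
    m ≤ pullCount A a T ω := by
  by_contra! ha
  obtain ⟨b, hb⟩ := exists_le_pullCount (A := A) (ω := ω) (4 * m + 1) a hT
  obtain ⟨t, htT, hAt, hbt⟩ := exists_last_pull (A := A) (b := b) (T := T) (ω := ω) (by omega)
  -- Before round `K` arm `b` has at most one pull, but here it has at least `4m`.
  have hKt : K ≤ t := by
    by_contra! hlt
    have := pullCount_mono (A := A) (a := b) (ω := ω) hlt.le
    rw [hinit b] at this
    omega
  have hna : 1 ≤ pullCount A a t ω := (hinit a).symm.le.trans (pullCount_mono hKt)
  have hnb : 4 * m ≤ pullCount A b t ω := by omega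
  have hnat : pullCount A a t ω ≤ m := (pullCount_mono htT.le).trans ha.le
  -- The ratio of final to current pulls is at most `m` for `a`, which has fewer than `m` pulls in
  -- all, and at most `2` for `b`, which is pulled only once more.
  have hda := abs_sampleMean_sub_le (r := m) htT.le hna hC0 (hC a) (by
    have h1 : (pullCount A a T ω : ℝ) ≤ m := by exact_mod_cast ha.le
    have h2 : (1 : ℝ) ≤ pullCount A a t ω := by exact_mod_cast hna
    nlinarith)
  have hdb := abs_sampleMean_sub_le (r := 2) htT.le (by omega) hC0 (hC b) (by
    rw [hbt]
    have h2 : (1 : ℝ) ≤ pullCount A b t ω := by exact_mod_cast (by omega)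
    push_cast
    linarith)
  have hidx := hrule t hKt htT a
  rw [hAt, ucbIndex, ucbIndex] at hidx
  have hlog : 0 ≤ 2 * Real.log (T : ℝ) := mul_nonneg zero_le_two (Real.log_natCast_nonneg T)
  have hm0 : (0 : ℝ) < m := by exact_mod_cast hm
  have hsa : √(2 * Real.log (T : ℝ) / m) ≤ √(2 * Real.log (T : ℝ) / pullCount A a t ω) := by
    have h1 : (0 : ℝ) < pullCount A a t ω := by exact_mod_cast hna
    gcongr
  -- Four times as many pulls halve the bonus.
  have hsb : √(2 * Real.log (T : ℝ) / pullCount A b t ω) ≤ √(2 * Real.log (T : ℝ) / m) / 2 := by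
    have h1 : (4 * m : ℝ) ≤ pullCount A b t ω := by exact_mod_cast hnb
    calc √(2 * Real.log (T : ℝ) / pullCount A b t ω) ≤ √(2 * Real.log (T : ℝ) / m / 2 ^ 2) := by
          rw [div_div]
          gcongr
          linarith
      _ = _ := by rw [Real.sqrt_div' _ (by positivity), Real.sqrt_sq zero_le_two]
  have h1 := (abs_le.1 hda).1
  have h2 := (abs_le.1 hdb).2
  linarith [hg b]

/-- The error `6δ` is `2δ` from the centred second moment plus `(2δ)² ≤ 4δ` from the squared mean.
-/
lemma abs_varEstimator_sub_lt {c v δ : ℝ} (hm : 1 ≤ m) (hn : m ≤ pullCount A a T ω)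
    (hδ0 : 0 < δ) (hδ : δ ≤ 1)
    (h1 : |armSum A X (fun x => x - c) a T ω| < δ * (pullCount A a T ω + m))
    (h2 : |armSum A X (fun x => (x - c) ^ 2 - v) a T ω| < δ * (pullCount A a T ω + m)) :
    |varEstimator A X a T ω - v| < 6 * δ := by
  have hn0 : 0 < pullCount A a T ω := by omega
  rw [varEstimator_eq c hn0]
  rw [armSum_sub, armSum_const] at h2
  set N : ℝ := ((pullCount A a T ω : ℕ) : ℝ)
  have hN : 0 < N := by simp only [N]; exact_mod_cast hn0
  have hmN : (m : ℝ) ≤ N := by simp only [N]; exact_mod_cast hn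
  have hb : δ * (N + m) ≤ 2 * δ * N := by nlinarith
  have e2 : |armSum A X (fun x => (x - c) ^ 2) a T ω / N - v| < 2 * δ := by
    have : armSum A X (fun x => (x - c) ^ 2) a T ω / N - v =
        (armSum A X (fun x => (x - c) ^ 2) a T ω - N * v) / N := by field_simp
    rw [this, abs_div, abs_of_pos hN, div_lt_iff₀ hN]
    linarith
  have e1 : |armSum A X (fun x => x - c) a T ω / N| < 2 * δ := by
    rw [abs_div, abs_of_pos hN, div_lt_iff₀ hN]
    linarith
  have e3 : (armSum A X (fun x => x - c) a T ω / N) ^ 2 ≤ 4 * δ := by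
    rw [← sq_abs]
    nlinarith [abs_nonneg (armSum A X (fun x => x - c) a T ω / N)]
  have e4 := sq_nonneg (armSum A X (fun x => x - c) a T ω / N)
  rw [abs_lt] at e2 ⊢
  constructor <;> linarith

end Exploration

/-! ### Probability bounds and the limit -/

section Consistency

variable {Ω : Type*} {K : ℕ} [mΩ : MeasurableSpace Ω] {ν : Measure Ω} [IsProbabilityMeasure ν]
  {ℱ : Filtration ℕ mΩ} {P : Fin K → Measure ℝ} {T m : ℕ} {A : ℕ → Ω → Fin K}
  {X : ℕ → Ω → ℝ} {lam : Fin K → ℝ} {B g δ : ℝ}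

/-- The empirical second moment of an arm around its mean is at most of order `√m`, up to
probability of order `1 / m`. -/
lemma IsUCBRun.measure_secondMoment_gt_le (h : IsUCBRun ν ℱ P T A X)
    (hP : ∀ a, IsProbabilityMeasure (P a)) (hsub : ∀ a, IsSubGaussian (lam a) (P a))
    (hlam : ∀ a, |lam a| ≤ B) (hKT : K ≤ T) (hm : 1 ≤ m) (b : Fin K) :
    ν {ω | (∀ b, pullCount A b K ω = 1) ∧
        (2 * √m + momentBound B) * pullCount A b T ω <
          armSum A X (fun x => (x - mean (P b)) ^ 2) b T ω} ≤
      ENNReal.ofReal (momentBound B / m) := by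
  have hm0 : (0 : ℝ) < m := by exact_mod_cast hm
  have hs : 0 < √(m : ℝ) := Real.sqrt_pos.2 hm0
  have := hP b
  -- Used with shift `1` and level `√m`; since `n ≥ 1`, the threshold `√m (n + 1)` is at most `2 √m
  -- n`.
  have key := h.measure_armSum_ge_le (a := b)
    (f := fun x => (x - mean (P b)) ^ 2 - variance id (P b)) hP (by fun_prop)
    ((hsub b).memLp_two_sq.sub (memLp_const _)) (hsub b).integral_sq_sub_variance
    ((hsub b).integral_sq_sub_variance_sq_le (hlam b)) one_pos hs
  rw [one_mul, Real.sq_sqrt hm0.le] at key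
  refine (measure_mono ?_).trans key
  rintro ω ⟨hinit, hω⟩
  have hn : (1 : ℝ) ≤ pullCount A b T ω := by
    exact_mod_cast (hinit b).symm.le.trans (pullCount_mono hKT)
  have hv := (hsub b).variance_le (hlam b)
  rw [Set.mem_ofPred_eq, armSum_sub, armSum_const]
  refine le_trans ?_ (le_abs_self _)
  nlinarith

/-- Union bound over `K + 2` bad events: one second-moment event for each arm, which secures `m`
pulls of `a`, and two deviation events for `a`. -/
lemma IsUCBRun.measure_varEstimator_sub_ge_le (h : IsUCBRun ν ℱ P T A X)
    (hP : ∀ a, IsProbabilityMeasure (P a)) (hsub : ∀ a, IsSubGaussian (lam a) (P a))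
    (hlam : ∀ a, |lam a| ≤ B) (hKT : K ≤ T) (hm : 1 ≤ m) (a : Fin K)
    (hT : K * (4 * m + 1) ≤ T) (hg : gap P a ≤ g)
    (hbig : (m + 2) * (2 * √m + momentBound B + 1) + g < √(2 * Real.log (T : ℝ) / m) / 2)
    (hδ0 : 0 < δ) (hδ : δ ≤ 1) :
    ν {ω | 6 * δ ≤ |varEstimator A X a T ω - variance id (P a)|} ≤
      ENNReal.ofReal ((K + 2) * momentBound B / (m * δ ^ 2)) := by
  have hm0 : (0 : ℝ) < m := by exact_mod_cast hm
  have := hP a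
  have hMB := one_le_momentBound B
  set S₁ := {ω | δ * (pullCount A a T ω + m) ≤ |armSum A X (fun x => x - mean (P a)) a T ω|}
    with hS₁
  set S₂ := {ω | δ * (pullCount A a T ω + m) ≤
    |armSum A X (fun x => (x - mean (P a)) ^ 2 - variance id (P a)) a T ω|} with hS₂
  set D := fun b => {ω | (∀ b, pullCount A b K ω = 1) ∧
    (2 * √(m : ℝ) + momentBound B) * pullCount A b T ω <
      armSum A X (fun x => (x - mean (P b)) ^ 2) b T ω} with hD
  have b₁ : ν S₁ ≤ ENNReal.ofReal (momentBound B / (m * δ ^ 2)) := by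
    refine h.measure_armSum_ge_le hP (by fun_prop) (hsub a).memLp_two (hsub a).integral_sub_mean
      ?_ hm0 hδ0
    rw [← variance_eq_integral_sub_mean_sq]
    exact (hsub a).variance_le (hlam a)
  have b₂ : ν S₂ ≤ ENNReal.ofReal (momentBound B / (m * δ ^ 2)) :=
    h.measure_armSum_ge_le hP (by fun_prop) ((hsub a).memLp_two_sq.sub (memLp_const _))
      (hsub a).integral_sq_sub_variance ((hsub a).integral_sq_sub_variance_sq_le (hlam a)) hm0 hδ0
  have b₃ : ∀ b, ν (D b) ≤ ENNReal.ofReal (momentBound B / (m * δ ^ 2)) := fun b => by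
    refine (h.measure_secondMoment_gt_le hP hsub hlam hKT hm b).trans
      (ENNReal.ofReal_le_ofReal ?_)
    have : δ ^ 2 ≤ 1 := pow_le_one₀ hδ0.le hδ
    gcongr
    nlinarith
  have hrule : ∀ᵐ ω ∂ν, ∀ t, K ≤ t → t < T →
      ∀ b, ucbIndex A X T b t ω ≤ ucbIndex A X T (A (t + 1) ω) t ω := by
    refine ae_all_iff.2 fun t => ?_
    by_cases ht : K ≤ t ∧ t < T
    · filter_upwards [h.ucb_rule t ht.1 ht.2] with ω hω _ _
      exact hω
    · exact .of_forall fun ω h1 h2 => absurd ⟨h1, h2⟩ ht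
  have hgap : ∀ b, mean (P b) - mean (P a) ≤ g := fun b => by
    refine le_trans ?_ hg
    rw [gap]
    gcongr
    exact le_ciSup (f := fun b => mean (P b)) (Set.finite_range _).bddAbove b
  have hcover : {ω | 6 * δ ≤ |varEstimator A X a T ω - variance id (P a)|} ≤ᵐ[ν]
      (S₁ ∪ S₂ ∪ ⋃ b, D b : Set Ω) := by
    filter_upwards [hrule, h.initial_pulls] with ω hω hinit hmem
    by_contra hnot
    have hnot' : ω ∉ (S₁ ∪ S₂ ∪ ⋃ b, D b : Set Ω) := hnot
    simp only [Set.mem_union, Set.mem_iUnion, not_or, not_exists] at hnot'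
    obtain ⟨⟨h1, h2⟩, h3⟩ := hnot'
    simp only [hS₁, hS₂, Set.mem_ofPred_eq, not_le] at h1 h2
    have h4 : ∀ b, armSum A X (fun x => (x - mean (P b)) ^ 2) b T ω ≤
        (2 * √(m : ℝ) + momentBound B) * pullCount A b T ω := fun b => by
      by_contra! hb
      exact h3 b ⟨hinit, hb⟩
    have h5 := le_pullCount_of_ucb (a := a) (μ := fun b => mean (P b)) hm (by positivity) hinit
      hω h4 hT hgap hbig
    have h6 : 6 * δ ≤ |varEstimator A X a T ω - variance id (P a)| := hmem
    exact absurd h6 (not_le.2 (abs_varEstimator_sub_lt hm h5 hδ0 hδ h1 h2))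
  have hq : 0 ≤ momentBound B / (m * δ ^ 2) := by positivity
  calc _ ≤ ν (S₁ ∪ S₂ ∪ ⋃ b, D b) := measure_mono_ae hcover
    _ ≤ ν S₁ + ν S₂ + ∑ b, ν (D b) := by
      refine (measure_union_le _ _).trans (add_le_add (measure_union_le _ _) ?_)
      exact measure_iUnion_fintype_le _ _
    _ ≤ ENNReal.ofReal (momentBound B / (m * δ ^ 2)) + ENNReal.ofReal (momentBound B / (m * δ ^ 2))
        + ∑ _b : Fin K, ENNReal.ofReal (momentBound B / (m * δ ^ 2)) := by
      gcongr with b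
      exact b₃ b
    _ = _ := by
      rw [Finset.sum_const, Finset.card_univ, Fintype.card_fin, nsmul_eq_mul,
        ← ENNReal.ofReal_natCast, ← ENNReal.ofReal_mul (by positivity),
        ← ENNReal.ofReal_add hq hq, ← ENNReal.ofReal_add (by positivity) (by positivity)]
      congr 1
      ring

lemma tendsto_sqrt_two_mul_log :
    Tendsto (fun T : ℕ => √(2 * Real.log (T : ℝ))) atTop atTop :=
  Real.tendsto_sqrt_atTop.comp
    ((Real.tendsto_log_atTop.comp tendsto_natCast_atTop_atTop).const_mul_atTop two_pos)

/-- A sequence that is negligible compared to `√(2 log T)` is eventually dominated by the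
exploration bonus. -/
lemma eventually_add_lt_sqrt_log {u : ℕ → ℝ}
    (hu : Tendsto (fun T : ℕ => u T / √(2 * Real.log (T : ℝ))) atTop (𝓝 0)) (hm : 1 ≤ m)
    (c : ℝ) : ∀ᶠ T : ℕ in atTop, c + u T < √(2 * Real.log (T : ℝ) / m) / 2 := by
  have hm0 : (0 : ℝ) < m := by exact_mod_cast hm
  have hs : 0 < √(m : ℝ) := Real.sqrt_pos.2 hm0
  have h1 : Tendsto (fun T : ℕ => c / √(2 * Real.log (T : ℝ)) + u T / √(2 * Real.log (T : ℝ)))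
      atTop (𝓝 0) := by
    simpa using (tendsto_sqrt_two_mul_log.const_div_atTop c).add hu
  filter_upwards [h1.eventually_lt_const (show 0 < 1 / (2 * √(m : ℝ)) by positivity),
    tendsto_sqrt_two_mul_log.eventually_gt_atTop 0] with T hT hpos
  rw [← add_div, div_lt_iff₀ hpos] at hT
  rw [Real.sqrt_div' _ hm0.le]
  exact hT.trans_eq (by ring)

end Consistency

end UCB

theorem corollary1 {K : ℕ}
    -- the reward distributions of the arms, which may change with the horizon `T`
    (P : ℕ → Fin K → Measure ℝ) (hP : ∀ T a, IsProbabilityMeasure (P T a))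
    -- `Δ_a / √(2 log T) = o(1)` for all arms
    (hgap : ∀ a, Tendsto (fun T : ℕ => UCB.gap (P T) a / √(2 * Real.log (T : ℝ))) atTop (𝓝 0))
    -- the arms are sub-Gaussian with uniformly bounded parameters
    (lam : ℕ → Fin K → ℝ) (B : ℝ) (hlam : ∀ T a, |lam T a| ≤ B)
    (hsub : ∀ T a, UCB.IsSubGaussian (lam T a) (P T a))
    -- for each horizon `T ≥ K`, a run of the UCB algorithm of horizon `T`
    {Ω : ℕ → Type*} [mΩ : ∀ T, MeasurableSpace (Ω T)]
    (ν : ∀ T, Measure (Ω T)) (hν : ∀ T, IsProbabilityMeasure (ν T))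
    (ℱ : ∀ T, Filtration ℕ (mΩ T))
    (A : ∀ T, ℕ → Ω T → Fin K) (X : ∀ T, ℕ → Ω T → ℝ)
    (hrun : ∀ T, K ≤ T → UCB.IsUCBRun (ν T) (ℱ T) (P T) T (A T) (X T)) :
    -- for every arm, the variance estimator is consistent
    ∀ a : Fin K, ∀ ε : ℝ, 0 < ε →
      Tendsto (fun T : ℕ =>
        ν T {ω | ε ≤ |UCB.varEstimator (A T) (X T) a T ω - variance id (P T a)|})
        atTop (𝓝 0) := by

  intro a ε hε
  set δ := min 1 (ε / 6) with hδ
  have hδ0 : 0 < δ := lt_min one_pos (by positivity)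
  have hδε : 6 * δ ≤ ε := by linarith [min_le_right (1 : ℝ) (ε / 6)]
  rw [ENNReal.tendsto_nhds_zero]
  intro η hη
  have hlim : Tendsto (fun m : ℕ =>
      ENNReal.ofReal ((K + 2) * UCB.momentBound B / (m * δ ^ 2))) atTop (𝓝 0) := by
    rw [← ENNReal.ofReal_zero]
    exact ENNReal.tendsto_ofReal
      ((tendsto_natCast_atTop_atTop.atTop_mul_const (by positivity)).const_div_atTop _)
  -- The failure bound depends on `m` but not on `T`, so `m` is chosen from `η` alone; `T` is then
  -- taken large for this `m`.
  obtain ⟨m, hmη, hm⟩ :=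
    ((hlim.eventually_le_const hη).and (eventually_ge_atTop 1)).exists
  filter_upwards [UCB.eventually_add_lt_sqrt_log (hgap a) hm
      ((m + 2) * (2 * √(m : ℝ) + UCB.momentBound B + 1)), eventually_ge_atTop K,
    eventually_ge_atTop (K * (4 * m + 1))] with T hbig hKT hT
  have := hν T
  refine (measure_mono fun ω hω => ?_).trans
    (((hrun T hKT).measure_varEstimator_sub_ge_le (hP T) (hsub T) (hlam T) hKT hm a hT le_rfl
      hbig hδ0 (min_le_left _ _)).trans hmη)
  exact hδε.trans hω
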